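/- Let $X$ be a complex Banach space and $1\le p<\infty$. Let $d\omega$ be the normalized Haar measure on the infinite-dimensional torus $\mathbb T^{\mathbb N}$, and for $f\in L_p(\mathbb T^{\mathbb N},X)$ and a finitely supported sequence of integers $\alpha\in\mathbb Z^{(\mathbb N)}$ put $\hat f(\alpha)=\int_{\mathbb T^{\mathbb N}} f(\omega)\,\omega^{-\alpha}\,d\omega$. Let $H_p(\mathbb T^{\mathbb N},X)$ be the closed subspace of those $f\in L_p(\mathbb T^{\mathbb N},X)$ with $\hat f(\alpha)=0$ whenever $\alpha\in\mathbb Z^{(\mathbb N)}\setminus\mathbb N_0^{(\mathbb N)}$. Let $\mathfrak p=(\mathfrak p_1<\mathfrak p_2<\dots)$ be the sequence of primes. * $\mathcal H_p(X)$ is the space of all formal Dirichlet series $\sum_{n\ge1} a_n n^{-s}$ for which there is $f\in H_p(\mathbb T^{\mathbb N},X)$ with $a_n=\hat f(\alpha)$ for every $n=\mathfrak p^\alpha$; such an $f$ is unique, and the norm of the series is $\|f\|_{L_p(\mathbb T^{\mathbb N},X)}$. * $\mathcal H_p^+(X)$ is the space of all formal Dirichlet series $D=\sum_n a_n n^{-s}$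 with coefficients in $X$ such that $D_\varepsilon:=\sum_n \frac{a_n}{n^{\varepsilon}} n^{-s}\in\mathcal H_p(X)$ for every $\varepsilon>0$ and $\|D\|_{\mathcal H_p^+(X)}:=\sup_{\varepsilon>0}\|D_\varepsilon\|_{\mathcal H_p(X)}<\infty$. * For a complex Banach space $Y$, $\mathfrak D_\infty(Y)$ is the space of all Dirichlet series $\sum_n y_n n^{-z}$ with coefficients $y_n\in Y$ that converge at every $z$ with $\operatorname{Re}z>0$ and define a bounded (and holomorphic) function $z\mapsto\sum_n y_n n^{-z}$ there, with the norm $\sup_{\operatorname{Re}z>0}\big\|\sum_n y_n n^{-z}\big\|_Y$. **Theorem.** The mapping $$\mathcal H_p^+(X)\hookrightarrow\mathfrak D_\infty(\mathcal H_p(X)),\qquad \sum_n a_n n^{-s}\mapsto\sum_n (a_n n^{-s})\,n^{-z},$$ is a well-defined linear isometric embedding. That is, for every $\sum_n a_n n^{-s}\in\mathcal H_p^+(X)$ each one-term Dirichlet series $a_n n^{-s}$ belongs to $\mathcal H_p(X)$, the Dirichlet series in $z$ whose $n$-th coefficient is $a_n n^{-s}\in\mathcal H_p(X)$ belongs to $\mathfrak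 D_\infty(\mathcal H_p(X))$, and its norm there equals $\big\|\sum_n a_n n^{-s}\big\|_{\mathcal H_p^+(X)}$. -/

import Mathlib

open MeasureTheory Filter Topology
open scoped ENNReal

/-- The Borel `σ`-algebra on the circle `𝕋`. -/
noncomputable instance Circle.instMeasurableSpaceBorel : MeasurableSpace Circle := borel Circle

instance Circle.instBorelSpaceBorel : BorelSpace Circle := ⟨rfl⟩

namespace DirichletHardy

/-- The infinite-dimensional torus `𝕋^ℕ`, a compact abelian group. -/
abbrev Torus : Type := ℕ → Circle

/-- The normalized Haar measure `dω` on `𝕋^ℕ`. -/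
noncomputable def haarT : Measure Torus :=
  Measure.haarMeasure (⊤ : TopologicalSpace.PositiveCompacts Torus)

instance : IsProbabilityMeasure haarT :=
  ⟨Measure.haarMeasure_self (K₀ := (⊤ : TopologicalSpace.PositiveCompacts Torus))⟩

instance : haarT.IsHaarMeasure := by unfold haarT; infer_instance

/-- The monomial `ω ↦ ω^α = ∏ₖ ωₖ^{αₖ}` on `𝕋^ℕ`, for `α ∈ ℤ^{(ℕ)}`. -/
noncomputable def monomial (α : ℕ →₀ ℤ) : C(Torus, ℂ) where
  toFun ω := ((α.prod fun k m => ω k ^ m : Circle) : ℂ)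
  continuous_toFun := by
    unfold Finsupp.prod
    fun_prop

theorem norm_monomial_apply (α : ℕ →₀ ℤ) (ω : Torus) : ‖monomial α ω‖ = 1 :=
  Circle.norm_coe _

section Lp

variable {p : ℝ≥0∞} [hp : Fact (1 ≤ p)] {X : Type*} [NormedAddCommGroup X] [NormedSpace ℂ X]

/-- The Fourier coefficient `∫ f(ω) ω^{-α} dω`. -/
noncomputable def fourierCoeff (f : Lp X p haarT) (α : ℕ →₀ ℤ) : X :=
  ∫ ω, monomial (-α) ω • f ω ∂haarT

theorem integrable_smul (g : C(Torus, ℂ)) (f : Lp X p haarT) :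
    Integrable (fun ω => g ω • f ω) haarT :=
  ((Lp.memLp f).integrable hp.out).bdd_smul ‖g‖ g.continuous.aestronglyMeasurable
    (Eventually.of_forall fun ω => g.norm_coe_le_norm ω)

theorem fourierCoeff_add (f g : Lp X p haarT) (α : ℕ →₀ ℤ) :
    fourierCoeff (f + g) α = fourierCoeff f α + fourierCoeff g α := by
  unfold fourierCoeff
  rw [← integral_add (integrable_smul _ f) (integrable_smul _ g)]
  refine integral_congr_ae ?_
  filter_upwards [Lp.coeFn_add f g] with ω h
  rw [h, Pi.add_apply, smul_add]

theorem fourierCoeff_smul (c : ℂ) (f : Lp X p haarT) (α : ℕ →₀ ℤ) :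
    fourierCoeff (c • f) α = c • fourierCoeff f α := by
  unfold fourierCoeff
  rw [← integral_smul]
  refine integral_congr_ae ?_
  filter_upwards [Lp.coeFn_smul c f] with ω h
  rw [h, Pi.smul_apply, smul_comm]

theorem monomial_add (α β : ℕ →₀ ℤ) : monomial (α + β) = monomial α * monomial β := by
  ext ω
  change ((((α + β).prod fun k m => ω k ^ m : Circle)) : ℂ) =
    ((α.prod fun k m => ω k ^ m : Circle) : ℂ) * ((β.prod fun k m => ω k ^ m : Circle) : ℂ)
  rw [Finsupp.prod_add_index' (fun _ => zpow_zero _) (fun _ _ _ => zpow_add _ _ _), Circle.coe_mul]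

theorem monomial_zero : monomial 0 = 1 := by
  ext ω
  simp [monomial]

theorem star_monomial (α : ℕ →₀ ℤ) : star (monomial α) = monomial (-α) := by
  ext ω
  have h : monomial α ω * monomial (-α) ω = 1 := by
    rw [← ContinuousMap.mul_apply, ← monomial_add, add_neg_cancel, monomial_zero]
    rfl
  have h1 : ((starRingEnd ℂ) (monomial α ω)) * monomial α ω = 1 := by
    rw [Complex.conj_mul', norm_monomial_apply]; simp
  calc (starRingEnd ℂ) (monomial α ω)
      = (starRingEnd ℂ) (monomial α ω) * (monomial α ω * monomial (-α) ω) := by rw [h, mul_one]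
    _ = monomial (-α) ω := by rw [← mul_assoc, h1, one_mul]

/-- The star algebra of trigonometric polynomials on `𝕋^ℕ`. -/
noncomputable def trigAlgebra : StarSubalgebra ℂ C(Torus, ℂ) where
  toSubalgebra := Algebra.adjoin ℂ (Set.range monomial)
  star_mem' := by
    change Algebra.adjoin ℂ (Set.range monomial) ≤ star (Algebra.adjoin ℂ (Set.range monomial))
    refine Algebra.adjoin_le ?_
    rintro _ ⟨α, rfl⟩
    exact Algebra.subset_adjoin ⟨-α, (star_monomial α).symm⟩

theorem trigAlgebra_coe :
    trigAlgebra.toSubalgebra.toSubmodule = Submodule.span ℂ (Set.range monomial) := by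
  apply Algebra.adjoin_eq_span_of_subset
  refine .trans (fun x => Submonoid.closure_induction (fun _ => id) ⟨0, monomial_zero⟩ ?_)
    Submodule.subset_span
  rintro _ _ _ _ ⟨α, rfl⟩ ⟨β, rfl⟩
  exact ⟨α + β, monomial_add α β⟩

theorem trigAlgebra_separatesPoints : trigAlgebra.SeparatesPoints := by
  intro x y hxy
  obtain ⟨k, hk⟩ := Function.ne_iff.mp hxy
  refine ⟨_, ⟨monomial (Finsupp.single k 1), Algebra.subset_adjoin ⟨_, rfl⟩, rfl⟩, ?_⟩
  intro h
  refine hk (Circle.coe_injective ?_)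
  simpa [monomial, Finsupp.prod_single_index] using h

/-- Trigonometric polynomials are dense in the continuous functions on `𝕋^ℕ`. -/
theorem span_monomial_closure :
    (Submodule.span ℂ (Set.range monomial)).topologicalClosure = ⊤ := by
  rw [← trigAlgebra_coe]
  exact congr_arg (Subalgebra.toSubmodule <| StarSubalgebra.toSubalgebra ·)
    (ContinuousMap.starSubalgebra_topologicalClosure_eq_top_of_separatesPoints _
      trigAlgebra_separatesPoints)

variable [CompleteSpace X]

theorem integral_smul_eq_zero (f : Lp X p haarT) (hf : ∀ α, fourierCoeff f α = 0)
    (g : C(Torus, ℂ)) : ∫ ω, g ω • f ω ∂haarT = 0 := by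
  have hL : Integrable f haarT := (Lp.memLp f).integrable hp.out
  let T : C(Torus, ℂ) →ₗ[ℂ] X :=
    { toFun := fun g => ∫ ω, g ω • f ω ∂haarT
      map_add' := fun a b => by
        rw [← integral_add (integrable_smul a f) (integrable_smul b f)]
        simp [add_smul]
      map_smul' := fun c a => by
        rw [RingHom.id_apply, ← integral_smul]
        simp [mul_smul] }
  have hT : ∀ g, ‖T g‖ ≤ (∫ ω, ‖f ω‖ ∂haarT) * ‖g‖ := fun g => by
    calc ‖T g‖ ≤ ∫ ω, ‖g ω • f ω‖ ∂haarT := norm_integral_le_integral_norm _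
      _ ≤ ∫ ω, ‖g‖ * ‖f ω‖ ∂haarT := by
        refine integral_mono (integrable_smul g f).norm (hL.norm.const_mul _) fun ω => ?_
        change ‖g ω • f ω‖ ≤ ‖g‖ * ‖f ω‖
        rw [norm_smul]
        gcongr
        exact g.norm_coe_le_norm ω
      _ = _ := by rw [integral_const_mul, mul_comm]
  let T' : C(Torus, ℂ) →L[ℂ] X := T.mkContinuous _ hT
  have hle : (Submodule.span ℂ (Set.range monomial)).topologicalClosure ≤
      LinearMap.ker (T' : C(Torus, ℂ) →ₗ[ℂ] X) := by
    refine Submodule.topologicalClosure_minimal _ (Submodule.span_le.mpr ?_) T'.isClosed_ker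
    rintro _ ⟨α, rfl⟩
    have h := hf (-α)
    rw [fourierCoeff, neg_neg] at h
    exact h
  rw [span_monomial_closure] at hle
  exact hle (Submodule.mem_top (x := g))

/-- A function in `L_p(𝕋^ℕ, X)` is determined by its Fourier coefficients. -/
theorem eq_zero_of_fourierCoeff (f : Lp X p haarT) (hf : ∀ α, fourierCoeff f α = 0) : f = 0 := by
  have hL : Integrable f haarT := (Lp.memLp f).integrable hp.out
  let : PseudoMetricSpace Torus := TopologicalSpace.pseudoMetrizableSpacePseudoMetric Torus
  refine Lp.ext (EventuallyEq.trans ?_ (Lp.coeFn_zero X p haarT).symm)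
  refine ae_eq_zero_of_forall_setIntegral_isClosed_eq_zero hL fun s hs => ?_
  let g : ℕ → C(Torus, ℂ) := fun n =>
    ⟨fun ω => ((hs.apprSeq n ω : NNReal) : ℂ), by fun_prop⟩
  have key : Tendsto (fun n => ∫ ω, g n ω • f ω ∂haarT) atTop
      (𝓝 (∫ ω, s.indicator f ω ∂haarT)) := by
    refine tendsto_integral_of_dominated_convergence (fun ω => ‖f ω‖)
      (fun n => (integrable_smul (g n) f).aestronglyMeasurable) hL.norm
      (fun n => Eventually.of_forall fun ω => ?_) (Eventually.of_forall fun ω => ?_)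
    · have h1 : ‖g n ω‖ ≤ 1 := by
        have := HasOuterApproxClosed.apprSeq_apply_le_one hs n ω
        simpa [g] using this
      calc ‖g n ω • f ω‖ = ‖g n ω‖ * ‖f ω‖ := norm_smul _ _
        _ ≤ 1 * ‖f ω‖ := by gcongr
        _ = ‖f ω‖ := one_mul _
    · have h2 := (tendsto_pi_nhds.mp (HasOuterApproxClosed.tendsto_apprSeq hs)) ω
      have h3 : Tendsto (fun n => g n ω) atTop
          (𝓝 (((s.indicator (fun _ => (1 : NNReal)) ω : NNReal)) : ℂ)) := by
        have hc : Continuous fun x : NNReal => ((x : ℝ) : ℂ) := by fun_prop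
        exact (hc.tendsto _).comp h2
      have h4 := h3.smul_const (f ω)
      convert h4 using 2
      by_cases hω : ω ∈ s <;> simp [hω]
  rw [← integral_indicator hs.measurableSet]
  refine tendsto_nhds_unique key ?_
  simp only [integral_smul_eq_zero f hf]
  exact tendsto_const_nhds

end Lp

/-- `H_p(𝕋^ℕ, X)`: the functions in `L_p(𝕋^ℕ, X)` whose Fourier coefficients vanish at every
`α ∈ ℤ^{(ℕ)}` having a negative entry. It carries the norm of `L_p(𝕋^ℕ, X)`. -/
noncomputable def HpTorus (p : ℝ≥0∞) [Fact (1 ≤ p)] (X : Type*) [NormedAddCommGroup X]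
    [NormedSpace ℂ X] : Submodule ℂ (Lp X p haarT) where
  carrier := {f | ∀ α : ℕ →₀ ℤ, (∃ k, α k < 0) → fourierCoeff f α = 0}
  add_mem' hf hg α hα := by rw [fourierCoeff_add, hf α hα, hg α hα, add_zero]
  zero_mem' α _ := by
    have h := fourierCoeff_smul (0 : ℂ) (0 : Lp X p haarT) α
    rwa [zero_smul, zero_smul] at h
  smul_mem' c f hf α hα := by rw [fourierCoeff_smul, hf α hα, smul_zero]

/-- The exponent `α ∈ ℕ₀^{(ℕ)}` with `n = 𝔭^α`, where `𝔭₀ < 𝔭₁ < …` are the primes: `αₖ` is the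
multiplicity of the prime `𝔭ₖ` in `n`. -/
noncomputable def exponent (n : ℕ+) : ℕ →₀ ℕ :=
  (n : ℕ).factorization.comapDomain (Nat.nth Nat.Prime)
    (Nat.nth_injective Nat.infinite_setOfPred_prime).injOn

/-- `n = 𝔭^α` for `α = exponent n`. -/
theorem prod_pow_exponent (n : ℕ+) :
    ((exponent n).prod fun k e => Nat.nth Nat.Prime k ^ e) = n := by
  have hinj := Nat.nth_injective Nat.infinite_setOfPred_prime
  have h : ((exponent n).mapDomain (Nat.nth Nat.Prime)) = (n : ℕ).factorization := by
    refine Finsupp.mapDomain_comapDomain _ hinj _ fun q hq => ?_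
    rw [Nat.range_nth_of_infinite Nat.infinite_setOfPred_prime]
    exact Nat.prime_of_mem_primeFactors hq
  have h2 := Nat.prod_factorization_pow_eq_self n.ne_zero
  rwa [← h, Finsupp.prod_mapDomain_index_inj hinj] at h2

theorem exponent_surjective : Function.Surjective exponent := by
  intro α
  have hinj := Nat.nth_injective Nat.infinite_setOfPred_prime
  let g := α.mapDomain (Nat.nth Nat.Prime)
  have hg : ∀ q ∈ g.support, Nat.Prime q := fun q hq => by
    obtain ⟨k, -, rfl⟩ := Finset.mem_image.mp (Finsupp.mapDomain_support hq)
    exact Nat.prime_nth_prime k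
  have hpos : 0 < g.prod (· ^ ·) :=
    Finset.prod_pos fun q hq => pow_pos (hg q hq).pos _
  refine ⟨⟨_, hpos⟩, ?_⟩
  ext k
  change (g.prod (· ^ ·)).factorization (Nat.nth Nat.Prime k) = α k
  rw [Nat.prod_pow_factorization_eq_self hg]
  exact Finsupp.mapDomain_apply hinj _ _

/-- `α ∈ ℕ₀^{(ℕ)}` seen in `ℤ^{(ℕ)}`. -/
noncomputable def toIntExponent (α : ℕ →₀ ℕ) : ℕ →₀ ℤ :=
  α.mapRange (fun m : ℕ => (m : ℤ)) Nat.cast_zero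

/-- A formal Dirichlet series `∑ₙ aₙ n^{-s}` with coefficients in `X`, given by `(aₙ)_{n ≥ 1}`. -/
abbrev DirichletSeries (X : Type*) : Type _ := ℕ+ → X

section Hp

variable (p : ℝ≥0∞) [Fact (1 ≤ p)] (X : Type*) [NormedAddCommGroup X] [NormedSpace ℂ X]

/-- Bohr's transform on `H_p(𝕋^ℕ, X)`: the series with `aₙ = f̂(α)` for `n = 𝔭^α`. -/
noncomputable def bohr : HpTorus p X →ₗ[ℂ] DirichletSeries X where
  toFun f n := fourierCoeff (f : Lp X p haarT) (toIntExponent (exponent n))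
  map_add' _ _ := funext fun _ => fourierCoeff_add _ _ _
  map_smul' _ _ := funext fun _ => fourierCoeff_smul _ _ _

theorem bohr_injective [CompleteSpace X] : Function.Injective (bohr p X) := by
  rw [← LinearMap.ker_eq_bot, LinearMap.ker_eq_bot']
  intro f hf
  refine Subtype.ext (eq_zero_of_fourierCoeff _ fun α => ?_)
  by_cases hα : ∃ k, α k < 0
  · exact f.2 α hα
  · push Not at hα
    obtain ⟨n, hn⟩ := exponent_surjective (α.mapRange Int.toNat rfl)
    have h := congr_fun hf n
    have hαn : toIntExponent (exponent n) = α := by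
      rw [hn]
      ext k
      simp [toIntExponent, hα k]
    change fourierCoeff (f : Lp X p haarT) (toIntExponent (exponent n)) = 0 at h
    rwa [hαn] at h

/-- The Dirichlet series in `𝓗_p(X)`: the image of `H_p(𝕋^ℕ, X)` under Bohr's transform. -/
noncomputable def hardySubmodule : Submodule ℂ (DirichletSeries X) := LinearMap.range (bohr p X)

/-- The space `𝓗_p(X)` of Dirichlet series. It is a type of its own, so that it does not inherit
the topology of pointwise convergence. -/
def Hardy : Type _ := hardySubmodule p X

noncomputable instance : AddCommGroup (Hardy p X) :=
  inferInstanceAs (AddCommGroup (hardySubmodule p X))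

noncomputable instance : Module ℂ (Hardy p X) :=
  inferInstanceAs (Module ℂ (hardySubmodule p X))

variable {p X} in
/-- A Dirichlet series in the image of Bohr's transform, as an element of `𝓗_p(X)`. -/
def Hardy.mk (D : DirichletSeries X) (h : D ∈ hardySubmodule p X) : Hardy p X := ⟨D, h⟩

variable {p X} in
/-- The Dirichlet series underlying an element of `𝓗_p(X)`. -/
noncomputable def Hardy.series : Hardy p X →ₗ[ℂ] DirichletSeries X := (hardySubmodule p X).subtype

variable [CompleteSpace X]

/-- Bohr's transform as a linear bijection of `H_p(𝕋^ℕ, X)` onto `𝓗_p(X)`. -/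
noncomputable def bohrEquiv : HpTorus p X ≃ₗ[ℂ] Hardy p X :=
  LinearEquiv.ofInjective (bohr p X) (bohr_injective p X)

/-- The norm of `𝓗_p(X)` is the one that makes Bohr's transform an isometry. -/
noncomputable instance : NormedAddCommGroup (Hardy p X) :=
  NormedAddCommGroup.induced (Hardy p X) (HpTorus p X) (bohrEquiv p X).symm
    (bohrEquiv p X).symm.injective

noncomputable instance : NormedSpace ℂ (Hardy p X) :=
  NormedSpace.induced ℂ (Hardy p X) (HpTorus p X) (bohrEquiv p X).symm

theorem norm_bohrEquiv (f : HpTorus p X) : ‖bohrEquiv p X f‖ = ‖f‖ := by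
  change ‖(bohrEquiv p X).symm (bohrEquiv p X f)‖ = ‖f‖
  rw [LinearEquiv.symm_apply_apply]

end Hp

/-- The translate `D_z = ∑ₙ (aₙ / n^z) n^{-s}` of `D = ∑ₙ aₙ n^{-s}`. -/
noncomputable def translate {X : Type*} [NormedAddCommGroup X] [NormedSpace ℂ X] (z : ℂ) :
    DirichletSeries X →ₗ[ℂ] DirichletSeries X where
  toFun a n := (((n : ℕ) : ℂ) ^ (-z)) • a n
  map_add' _ _ := funext fun _ => smul_add _ _ _
  map_smul' _ _ := funext fun _ => smul_comm _ _ _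

section HpPlus

variable (p : ℝ≥0∞) [Fact (1 ≤ p)] (X : Type*) [NormedAddCommGroup X] [NormedSpace ℂ X]
  [CompleteSpace X]

/-- The Dirichlet series `D` such that `D_ε ∈ 𝓗_p(X)` for every `ε > 0` and
`sup_{ε > 0} ‖D_ε‖_{𝓗_p(X)} < ∞`. -/
noncomputable def hardyPlusSubmodule : Submodule ℂ (DirichletSeries X) where
  carrier := {D | ∃ h : ∀ ε : Set.Ioi (0 : ℝ), translate ((ε : ℝ) : ℂ) D ∈ hardySubmodule p X,
    BddAbove (Set.range fun ε : Set.Ioi (0 : ℝ) => ‖Hardy.mk _ (h ε)‖)}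
  add_mem' := by
    rintro D E ⟨hD, C, hC⟩ ⟨hE, C', hC'⟩
    have h : ∀ ε : Set.Ioi (0 : ℝ), translate ((ε : ℝ) : ℂ) (D + E) ∈ hardySubmodule p X :=
      fun ε => by rw [map_add]; exact add_mem (hD ε) (hE ε)
    refine ⟨h, C + C', ?_⟩
    rintro _ ⟨ε, rfl⟩
    have he : Hardy.mk _ (h ε) = Hardy.mk _ (hD ε) + Hardy.mk _ (hE ε) :=
      Subtype.ext (map_add _ _ _)
    change ‖Hardy.mk _ (h ε)‖ ≤ _
    rw [he]
    exact (norm_add_le _ _).trans (add_le_add (hC ⟨ε, rfl⟩) (hC' ⟨ε, rfl⟩))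
  zero_mem' := by
    have h : ∀ ε : Set.Ioi (0 : ℝ),
        translate ((ε : ℝ) : ℂ) (0 : DirichletSeries X) ∈ hardySubmodule p X :=
      fun ε => by rw [map_zero]; exact zero_mem _
    refine ⟨h, 0, ?_⟩
    rintro _ ⟨ε, rfl⟩
    have he : Hardy.mk _ (h ε) = 0 := Subtype.ext (map_zero _)
    change ‖Hardy.mk _ (h ε)‖ ≤ _
    rw [he, norm_zero]
  smul_mem' := by
    rintro c D ⟨hD, C, hC⟩
    have h : ∀ ε : Set.Ioi (0 : ℝ), translate ((ε : ℝ) : ℂ) (c • D) ∈ hardySubmodule p X :=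
      fun ε => by rw [map_smul]; exact Submodule.smul_mem _ c (hD ε)
    refine ⟨h, ‖c‖ * C, ?_⟩
    rintro _ ⟨ε, rfl⟩
    have he : Hardy.mk _ (h ε) = c • Hardy.mk _ (hD ε) := Subtype.ext (map_smul _ _ _)
    change ‖Hardy.mk _ (h ε)‖ ≤ _
    rw [he, norm_smul]
    exact mul_le_mul_of_nonneg_left (hC ⟨ε, rfl⟩) (norm_nonneg c)

/-- The space `𝓗_p⁺(X)`. -/
def HardyPlus : Type _ := hardyPlusSubmodule p X

noncomputable instance : AddCommGroup (HardyPlus p X) :=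
  inferInstanceAs (AddCommGroup (hardyPlusSubmodule p X))

noncomputable instance : Module ℂ (HardyPlus p X) :=
  inferInstanceAs (Module ℂ (hardyPlusSubmodule p X))

variable {p X}

/-- The Dirichlet series underlying an element of `𝓗_p⁺(X)`. -/
noncomputable def HardyPlus.series : HardyPlus p X →ₗ[ℂ] DirichletSeries X := (hardyPlusSubmodule p X).subtype

/-- The map `D ↦ D_ε` from `𝓗_p⁺(X)` to `𝓗_p(X)`, for `ε > 0`. -/
noncomputable def HardyPlus.shift (ε : Set.Ioi (0 : ℝ)) : HardyPlus p X →ₗ[ℂ] Hardy p X where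
  toFun D := Hardy.mk (translate ((ε : ℝ) : ℂ) D.series) (D.2.choose ε)
  map_add' D E := Subtype.ext (map_add (translate ((ε : ℝ) : ℂ)) D.series E.series)
  map_smul' c D := Subtype.ext (map_smul (translate ((ε : ℝ) : ℂ)) c D.series)

/-- `‖D‖_{𝓗_p⁺(X)} = sup_{ε > 0} ‖D_ε‖_{𝓗_p(X)}`. -/
noncomputable instance : Norm (HardyPlus p X) :=
  ⟨fun D => ⨆ ε : Set.Ioi (0 : ℝ), ‖HardyPlus.shift ε D‖⟩

theorem HardyPlus.norm_def (D : HardyPlus p X) :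
    ‖D‖ = ⨆ ε : Set.Ioi (0 : ℝ), ‖HardyPlus.shift ε D‖ := rfl

theorem HardyPlus.bddAbove (D : HardyPlus p X) :
    BddAbove (Set.range fun ε : Set.Ioi (0 : ℝ) => ‖HardyPlus.shift ε D‖) :=
  D.2.choose_spec

theorem HardyPlus.core : NormedSpace.Core ℂ (HardyPlus p X) where
  norm_nonneg D := Real.iSup_nonneg fun ε => norm_nonneg _
  norm_smul c D := by
    simp only [HardyPlus.norm_def, map_smul, norm_smul]
    exact (Real.mul_iSup_of_nonneg (norm_nonneg c) _).symm
  norm_triangle D E := by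
    have : Nonempty (Set.Ioi (0 : ℝ)) := ⟨⟨1, one_pos (α := ℝ)⟩⟩
    refine ciSup_le fun ε => ?_
    rw [map_add]
    exact (norm_add_le _ _).trans
      (add_le_add (le_ciSup D.bddAbove ε) (le_ciSup E.bddAbove ε))
  norm_eq_zero_iff D := by
    refine ⟨fun h => ?_, fun h => ?_⟩
    · have h1 : ‖HardyPlus.shift ⟨1, one_pos (α := ℝ)⟩ D‖ ≤ 0 :=
        (le_ciSup D.bddAbove ⟨1, one_pos (α := ℝ)⟩).trans_eq h
      have h2 := norm_le_zero_iff.mp h1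
      refine Subtype.ext (funext fun n => ?_)
      have h3 := congr_fun (congr_arg Hardy.series h2) n
      change (((n : ℕ) : ℂ) ^ (-(((1 : ℝ)) : ℂ))) • D.series n = 0 at h3
      refine (smul_eq_zero.mp h3).resolve_left ?_
      rw [Complex.cpow_eq_zero_iff]
      simp
    · rw [h, HardyPlus.norm_def]
      simp

noncomputable instance : NormedAddCommGroup (HardyPlus p X) :=
  NormedAddCommGroup.ofCore HardyPlus.core

noncomputable instance : NormedSpace ℂ (HardyPlus p X) := NormedSpace.ofCore HardyPlus.core

end HpPlus

section DInfty

/-- The open half-plane `ℂ₀ = {s : Re s > 0}`. -/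
def halfPlane : Set ℂ := {s | 0 < s.re}

/-- The partial sum `∑_{n ≤ N} aₙ n^{-s}`. -/
noncomputable def partialSum {Y : Type*} [NormedAddCommGroup Y] [NormedSpace ℂ Y]
    (a : DirichletSeries Y) (s : ℂ) (N : ℕ+) : Y :=
  ∑ n ∈ Finset.Icc 1 N, (((n : ℕ) : ℂ) ^ (-s)) • a n

variable (Y : Type*) [NormedAddCommGroup Y] [NormedSpace ℂ Y]

/-- The Dirichlet series which converge at every point of `ℂ₀` to a bounded holomorphic
function on `ℂ₀`. -/
def dInftySubmodule : Submodule ℂ (DirichletSeries Y) where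
  carrier := {a | ∃ F : ℂ → Y, (∀ s ∈ halfPlane, Tendsto (partialSum a s) atTop (𝓝 (F s))) ∧
    DifferentiableOn ℂ F halfPlane ∧ ∃ C : ℝ, ∀ s ∈ halfPlane, ‖F s‖ ≤ C}
  add_mem' := by
    rintro a b ⟨F, hF, hF', C, hC⟩ ⟨G, hG, hG', C', hC'⟩
    refine ⟨F + G, fun s hs => ?_, hF'.add hG', C + C', fun s hs =>
      (norm_add_le _ _).trans (add_le_add (hC s hs) (hC' s hs))⟩
    refine ((hF s hs).add (hG s hs)).congr fun N => ?_
    simp [partialSum, smul_add, Finset.sum_add_distrib]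
  zero_mem' := ⟨0, fun s _ => tendsto_const_nhds.congr fun N => by simp [partialSum], differentiableOn_const 0, 0,
    by simp⟩
  smul_mem' := by
    rintro c a ⟨F, hF, hF', C, hC⟩
    refine ⟨c • F, fun s hs => ?_, hF'.const_smul c, ‖c‖ * C, fun s hs => ?_⟩
    · refine ((hF s hs).const_smul c).congr fun N => ?_
      simp only [partialSum, Finset.smul_sum, Pi.smul_apply]
      exact Finset.sum_congr rfl fun n _ => smul_comm _ _ _
    · rw [Pi.smul_apply, norm_smul]
      exact mul_le_mul_of_nonneg_left (hC s hs) (norm_nonneg c)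

/-- The space `𝔇_∞(Y)` of bounded Dirichlet series. -/
def DInfty : Type _ := dInftySubmodule Y

noncomputable instance : AddCommGroup (DInfty Y) :=
  inferInstanceAs (AddCommGroup (dInftySubmodule Y))

noncomputable instance : Module ℂ (DInfty Y) :=
  inferInstanceAs (Module ℂ (dInftySubmodule Y))

variable {Y}

/-- The Dirichlet series underlying an element of `𝔇_∞(Y)`. -/
def DInfty.series : DInfty Y →ₗ[ℂ] DirichletSeries Y := (dInftySubmodule Y).subtype

/-- The limit function `D(s)` of `D ∈ 𝔇_∞(Y)`. -/
noncomputable def DInfty.eval (D : DInfty Y) (s : ℂ) : Y := limUnder atTop (partialSum D.series s)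

theorem DInfty.tendsto_eval (D : DInfty Y) {s : ℂ} (hs : s ∈ halfPlane) :
    Tendsto (partialSum D.series s) atTop (𝓝 (D.eval s)) := by
  obtain ⟨F, hF, -⟩ := D.2
  exact tendsto_nhds_limUnder ⟨F s, hF s hs⟩

theorem DInfty.eval_add (D E : DInfty Y) {s : ℂ} (hs : s ∈ halfPlane) :
    (D + E).eval s = D.eval s + E.eval s := by
  refine tendsto_nhds_unique ((D + E).tendsto_eval hs)
    (((D.tendsto_eval hs).add (E.tendsto_eval hs)).congr fun N => ?_)
  simp [partialSum, smul_add, Finset.sum_add_distrib]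

theorem DInfty.eval_smul (c : ℂ) (D : DInfty Y) {s : ℂ} (hs : s ∈ halfPlane) :
    (c • D).eval s = c • D.eval s := by
  refine tendsto_nhds_unique ((c • D).tendsto_eval hs)
    (((D.tendsto_eval hs).const_smul c).congr fun N => ?_)
  simp only [partialSum, Finset.smul_sum, map_smul, Pi.smul_apply]
  exact Finset.sum_congr rfl fun n _ => smul_comm _ _ _

/-- `‖D‖_{𝔇_∞(Y)} = sup_{s ∈ ℂ₀} ‖D(s)‖`. -/
noncomputable instance : Norm (DInfty Y) := ⟨fun D => ⨆ s : halfPlane, ‖D.eval s‖⟩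

theorem DInfty.norm_def (D : DInfty Y) : ‖D‖ = ⨆ s : halfPlane, ‖D.eval s‖ := rfl

theorem DInfty.bddAbove (D : DInfty Y) :
    BddAbove (Set.range fun s : halfPlane => ‖D.eval s‖) := by
  obtain ⟨F, hF, -, C, hC⟩ := D.2
  refine ⟨C, ?_⟩
  rintro _ ⟨s, rfl⟩
  change ‖D.eval s‖ ≤ C
  rw [tendsto_nhds_unique (D.tendsto_eval s.2) (hF s s.2)]
  exact hC s s.2

/-- A Dirichlet series that converges to `0` on `ℂ₀` has vanishing coefficients. -/
theorem eq_zero_of_tendsto_zero (a : DirichletSeries Y)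
    (h : ∀ s ∈ halfPlane, Tendsto (partialSum a s) atTop (𝓝 0)) : a = 0 := by
  have hsucc : Tendsto Nat.succPNat atTop atTop :=
    tendsto_atTop_atTop.mpr fun N => ⟨N, fun n hn => by
      rw [← PNat.coe_le_coe, Nat.succPNat_coe]
      exact hn.trans n.le_succ⟩
  have hstep : ∀ (s : ℂ) (N : ℕ), partialSum a s (N + 1).succPNat =
      partialSum a s N.succPNat + (((N + 1).succPNat : ℕ) : ℂ) ^ (-s) • a (N + 1).succPNat := by
    intro s N
    have he : Finset.Icc 1 (N + 1).succPNat =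
        insert (N + 1).succPNat (Finset.Icc 1 N.succPNat) := by
      ext m
      simp only [Finset.mem_Icc, Finset.mem_insert, ← PNat.coe_le_coe, ← PNat.coe_inj,
        Nat.succPNat_coe, PNat.one_coe]
      have := m.pos
      omega
    rw [partialSum, he, Finset.sum_insert, add_comm]
    · rfl
    · simp [← PNat.coe_le_coe]
  have hone : ∀ s : ℂ, partialSum a s (Nat.succPNat 0) = a 1 := fun s => by
    have he : Nat.succPNat 0 = 1 := rfl
    simp [partialSum, he]
  have hsum : ∀ (s : ℂ) (N : ℕ), partialSum a s N.succPNat =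
      ∑ i ∈ Finset.range (N + 1), ((i.succPNat : ℕ) : ℂ) ^ (-s) • a i.succPNat := by
    intro s N
    induction N with
    | zero => rw [hone]; simp; rfl
    | succ N ih => rw [hstep, ih, Finset.sum_range_succ _ (N + 1)]
  -- the coefficients grow at most linearly
  obtain ⟨C, hC⟩ : ∃ C : ℝ, ∀ i : ℕ, ‖a i.succPNat‖ ≤ C * (i.succPNat : ℕ) := by
    have h1 := (h 1 (by simp [halfPlane])).comp hsucc
    obtain ⟨B, hB⟩ := (Metric.isBounded_range_of_tendsto _ h1).exists_norm_le
    have hB' : ∀ i : ℕ, ‖partialSum a 1 i.succPNat‖ ≤ B := fun i => hB _ ⟨i, rfl⟩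
    have hterm : ∀ i : ℕ, ‖((i.succPNat : ℕ) : ℂ) ^ (-1 : ℂ) • a i.succPNat‖ ≤ B + B := by
      intro i
      cases i with
      | zero =>
        have h0 := hB' 0
        rw [hone] at h0
        have he : Nat.succPNat 0 = 1 := rfl
        rw [he]
        simp only [PNat.one_coe, Nat.cast_one, Complex.one_cpow, one_smul]
        linarith [norm_nonneg (a 1)]
      | succ i =>
        have he := hstep 1 i
        rw [← sub_eq_iff_eq_add'] at he
        rw [← he]
        exact (norm_sub_le _ _).trans (add_le_add (hB' _) (hB' _))
    refine ⟨B + B, fun i => ?_⟩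
    have h2 := hterm i
    have hpos : (0 : ℝ) < (i.succPNat : ℕ) := Nat.cast_pos.mpr i.succPNat.pos
    rw [norm_smul, Complex.cpow_neg_one, norm_inv, Complex.norm_natCast, inv_mul_le_iff₀ hpos] at h2
    linarith
  funext m
  refine SeparatingDual.eq_zero_of_forall_dual_eq_zero (R := ℂ) fun φ => ?_
  let f : ℕ → ℂ := fun n => if n = 0 then 0 else φ (a (n - 1).succPNat)
  have hf : ∀ s : ℂ, 2 < s.re → LSeriesSummable f s := by
    intro s hs
    refine LSeriesSummable_of_le_const_mul_rpow hs ⟨‖φ‖ * C, fun n hn => ?_⟩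
    have h1 : ((n - 1).succPNat : ℕ) = n := by rw [Nat.succPNat_coe]; omega
    have h2 := hC (n - 1)
    rw [h1] at h2
    have h3 : (2 : ℝ) - 1 = 1 := by norm_num
    rw [h3, Real.rpow_one, mul_assoc]
    simp only [f, if_neg hn]
    exact (φ.le_opNorm _).trans (mul_le_mul_of_nonneg_left h2 (norm_nonneg φ))
  have hzero : ∀ s : ℂ, 2 < s.re → LSeries f s = 0 := by
    intro s hs
    have h1 := (hf s hs).hasSum.tendsto_sum_nat.comp (tendsto_add_atTop_nat 2)
    have h2 := (φ.continuous.tendsto 0).comp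
      ((h s (show 0 < s.re by linarith)).comp hsucc)
    rw [map_zero] at h2
    refine tendsto_nhds_unique h1 (h2.congr fun N => ?_)
    simp only [Function.comp_apply]
    rw [hsum, map_sum, Finset.sum_range_succ' _ (N + 1), LSeries.term_zero, add_zero]
    refine Finset.sum_congr rfl fun i _ => ?_
    rw [LSeries.term_of_ne_zero (Nat.succ_ne_zero i)]
    simp only [f, map_smul, smul_eq_mul, Nat.succPNat_coe, Complex.cpow_neg]
    rw [if_neg (Nat.succ_ne_zero i), div_eq_inv_mul]
    rfl
  have hev : (fun x : ℝ => LSeries f x) =ᶠ[atTop] 0 := by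
    filter_upwards [eventually_gt_atTop (2 : ℝ)] with x hx
    exact hzero x (by simpa using hx)
  have habs : LSeries.abscissaOfAbsConv f ≠ ⊤ := by
    have h3 := (hf 3 (by norm_num)).abscissaOfAbsConv_le
    exact ne_top_of_le_ne_top (EReal.coe_ne_top _) h3
  have hfin := (LSeries_eventually_eq_zero_iff'.mp hev).resolve_right habs m m.ne_zero
  simp only [f, if_neg m.ne_zero] at hfin
  have hm : ((m : ℕ) - 1).succPNat = m := PNat.eq (by rw [Nat.succPNat_coe]; have := m.pos; omega)
  rwa [hm] at hfin

theorem DInfty.core : NormedSpace.Core ℂ (DInfty Y) where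
  norm_nonneg D := Real.iSup_nonneg fun s => norm_nonneg _
  norm_smul c D := by
    simp only [DInfty.norm_def]
    rw [Real.mul_iSup_of_nonneg (norm_nonneg c)]
    congr 1 with s
    rw [DInfty.eval_smul c D s.2, norm_smul]
  norm_triangle D E := by
    have : Nonempty halfPlane := ⟨⟨1, by simp [halfPlane]⟩⟩
    refine ciSup_le fun s => ?_
    rw [DInfty.eval_add D E s.2]
    exact (norm_add_le _ _).trans
      (add_le_add (le_ciSup D.bddAbove s) (le_ciSup E.bddAbove s))
  norm_eq_zero_iff D := by
    refine ⟨fun h => ?_, fun h => ?_⟩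
    · refine Subtype.ext (eq_zero_of_tendsto_zero D.series fun s hs => ?_)
      have h1 : ‖D.eval s‖ ≤ 0 := (le_ciSup D.bddAbove ⟨s, hs⟩).trans_eq h
      simpa [norm_le_zero_iff.mp h1] using D.tendsto_eval hs
    · subst h
      have h0 : ∀ s : halfPlane, (0 : DInfty Y).eval s = 0 := fun s => by
        simpa using DInfty.eval_smul 0 (0 : DInfty Y) s.2
      simp [DInfty.norm_def, h0]

noncomputable instance : NormedAddCommGroup (DInfty Y) := NormedAddCommGroup.ofCore DInfty.core

noncomputable instance : NormedSpace ℂ (DInfty Y) := NormedSpace.ofCore DInfty.core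

end DInfty

end DirichletHardy

namespace DirichletHardy

open scoped FourierTransform SchwartzMap

/-! ### The Kronecker flow and Fourier multipliers in `log n` -/

section Flow

/-! Translating a function on the torus by the point `(𝔭ₖ^{it})ₖ` preserves its `L_p` norm and
multiplies the coefficient `aₙ` by `n^{it}` (`Hardy.exists_rotate`). Hence, once the series `∑ₙ (aₙ
n^{-s}) n^{-z}` is known to converge in `𝓗_p(X)`, its sum at `z` is a rotation of `D_{Re z}` and has
the same norm. The supremum over the half-plane is then the supremum over `ε > 0`, which is the
isometry.

Convergence is the real content. Averaging the rotations against the Fourier transform of a Schwartz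
function `φ` gives the multiplier `φ((log n - A)/h)`, with a bound independent of `A` and `h`
(`Hardy.exists_multiplier`). Truncation at `N` is a smooth cutoff in `log n` that drops between `log
N` and `log (N + 1)`. Since this gap has size about `1/N`, the cutoff is a sum of `O(log N)` dyadic
bumps, each a uniformly bounded multiplier. So the partial sum operators have norm `O(log N)`, hence
`O(N^σ)` for every `σ > 0` (`Hardy.exists_truncation`). This argument needs no boundedness of a
Riesz projection, so it covers `p = 1` and every Banach space `X`.

Partial sums at `σ` are truncations of `D_σ`, so they grow at most like `N^σ`; summation by parts
turns this into convergence to a holomorphic function on the half-plane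
(`exists_tendsto_partialSum`). -/

theorem monomial_mul (α : ℕ →₀ ℤ) (ω τ : Torus) :
    monomial α (ω * τ) = monomial α ω * monomial α τ := by
  simp only [monomial, ContinuousMap.coe_mk, Pi.mul_apply, mul_zpow, Finsupp.prod_mul,
    Circle.coe_mul]

/-- The point `(𝔭ₖ^{it})ₖ` of the Kronecker flow on `𝕋^ℕ`. -/
noncomputable def flow (t : ℝ) : Torus := fun k => Circle.exp (t * Real.log (Nat.nth Nat.Prime k))

theorem continuous_flow : Continuous flow := by
  unfold flow
  fun_prop

/-- Unique factorization: `log n` is the sum of the `log 𝔭ₖ` weighted by the exponents, so the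
monomial belonging to `n` takes the value `n^{it}` on the flow. -/
theorem monomial_flow (n : ℕ+) (t : ℝ) :
    monomial (toIntExponent (exponent n)) (flow t) =
      Complex.exp (((t * Real.log (n : ℕ) : ℝ) : ℂ) * Complex.I) := by
  have h : Real.log (n : ℕ) =
      ∑ k ∈ (exponent n).support, (exponent n k : ℝ) * Real.log (Nat.nth Nat.Prime k) := by
    conv_lhs => rw [← prod_pow_exponent n]
    rw [Finsupp.prod, Nat.cast_prod, Real.log_prod]
    · simp
    · intro k _
      exact_mod_cast pow_ne_zero _ (Nat.prime_nth_prime k).ne_zero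
  have hexp : ∀ (s : Finset ℕ) (f : ℕ → ℝ), Circle.exp (∑ k ∈ s, f k) = ∏ k ∈ s, Circle.exp (f k) :=
    fun s f => by induction s using Finset.cons_induction <;> simp_all [Circle.exp_add]
  rw [← Circle.coe_exp]
  change ((_ : Circle) : ℂ) = _
  congr 1
  rw [toIntExponent, Finsupp.prod_mapRange_index fun _ => zpow_zero _, h, Finset.mul_sum,
    hexp, Finsupp.prod]
  refine Finset.prod_congr rfl fun k _ => ?_
  rw [zpow_natCast, flow, ← Circle.exp_natCast_mul]
  congr 1
  ring

variable {p : ℝ≥0∞} {X : Type*} [NormedAddCommGroup X] [NormedSpace ℂ X]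

/-- Invariance of Haar measure under `ω ↦ τω`, together with multiplicativity of the monomials. -/
theorem fourierCoeff_smul_flow (τ : Torus) (f : Lp X p haarT) (α : ℕ →₀ ℤ) :
    fourierCoeff (DomMulAct.mk τ • f) α = monomial α τ • fourierCoeff f α := by
  have h1 : fourierCoeff (DomMulAct.mk τ • f) α =
      ∫ ω, monomial (-α) ω • f (τ * ω) ∂haarT := by
    refine integral_congr_ae ?_
    filter_upwards [DomMulAct.smul_Lp_ae_eq (DomMulAct.mk τ) f] with ω hω
    rw [hω]
    rfl
  rw [h1, fourierCoeff, ← integral_smul,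
    ← integral_mul_left_eq_self (fun ω => monomial α τ • monomial (-α) ω • f ω) τ]
  refine integral_congr_ae (Eventually.of_forall fun ω => ?_)
  have h2 : monomial α τ * monomial (-α) τ = 1 := by
    rw [← ContinuousMap.mul_apply, ← monomial_add, add_neg_cancel, monomial_zero]
    rfl
  simp only
  rw [monomial_mul, smul_smul, ← mul_assoc, h2, one_mul]

variable [hp : Fact (1 ≤ p)]

/-- Monomials have modulus one, and the `L_1` norm is at most the `L_p` norm for a probability
measure. -/
theorem norm_fourierCoeff_le (α : ℕ →₀ ℤ) (f : Lp X p haarT) :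
    ‖fourierCoeff f α‖ ≤ ‖f‖ := by
  have hL : Integrable f haarT := (Lp.memLp f).integrable hp.out
  calc ‖fourierCoeff f α‖ ≤ ∫ ω, ‖monomial (-α) ω • f ω‖ ∂haarT :=
        norm_integral_le_integral_norm _
    _ = ∫ ω, ‖f ω‖ ∂haarT := by simp [norm_smul, norm_monomial_apply]
    _ = (eLpNorm f 1 haarT).toReal := by
        rw [integral_norm_eq_lintegral_enorm hL.aestronglyMeasurable, eLpNorm_one_eq_lintegral_enorm]
    _ ≤ (eLpNorm f p haarT).toReal :=
        ENNReal.toReal_mono (Lp.eLpNorm_ne_top f)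
          (eLpNorm_le_eLpNorm_of_exponent_le hp.out (Lp.aestronglyMeasurable f))
    _ = ‖f‖ := (Lp.norm_def f).symm

variable (p X) in
/-- The Fourier coefficient at `α` as a continuous linear map. -/
noncomputable def fourierCoeffCLM (α : ℕ →₀ ℤ) : Lp X p haarT →L[ℂ] X :=
  LinearMap.mkContinuous
    { toFun := fun f => fourierCoeff f α
      map_add' := fun f g => fourierCoeff_add f g α
      map_smul' := fun c f => fourierCoeff_smul c f α } 1
    fun f => by rw [one_mul]; exact norm_fourierCoeff_le α f

theorem fourierCoeffCLM_apply (α : ℕ →₀ ℤ) (f : Lp X p haarT) :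
    fourierCoeffCLM p X α f = fourierCoeff f α := rfl

/-- An intersection of kernels of continuous functionals. It yields completeness of `Hardy p X`,
needed to sum series there. -/
theorem isClosed_HpTorus : IsClosed (HpTorus p X : Set (Lp X p haarT)) := by
  have h : (HpTorus p X : Set (Lp X p haarT)) =
      ⋂ (α : ℕ →₀ ℤ) (_ : ∃ k, α k < 0), {f | fourierCoeffCLM p X α f = 0} := by
    ext f
    simp only [Set.mem_iInter]
    rfl
  rw [h]
  exact isClosed_iInter fun α => isClosed_iInter fun _ =>
    isClosed_eq (fourierCoeffCLM p X α).continuous continuous_const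

theorem Hardy.ext {f g : Hardy p X} (h : ∀ n, f.series n = g.series n) : f = g :=
  Subtype.ext (funext h)

variable [CompleteSpace X]

variable (p X) in
/-- Bohr's transform as an isometric isomorphism. -/
noncomputable def bohrIsometry : HpTorus p X ≃ₗᵢ[ℂ] Hardy p X where
  toLinearEquiv := bohrEquiv p X
  norm_map' := norm_bohrEquiv p X

theorem series_bohrIsometry (f : HpTorus p X) (n : ℕ+) :
    (bohrIsometry p X f).series n =
      fourierCoeff (f : Lp X p haarT) (toIntExponent (exponent n)) := rfl

instance : CompleteSpace (HpTorus p X) := isClosed_HpTorus.completeSpace_coe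

instance : CompleteSpace (Hardy p X) :=
  (completeSpace_congr (e := (bohrIsometry p X).toEquiv)
    (bohrIsometry p X).isometry.isUniformEmbedding).mp inferInstance

theorem Hardy.continuous_series (n : ℕ+) : Continuous fun f : Hardy p X => f.series n := by
  have h : (fun f : Hardy p X => f.series n) = fun f =>
      fourierCoeffCLM p X (toIntExponent (exponent n))
        ((bohrIsometry p X).symm f : HpTorus p X) := by
    funext f
    rw [fourierCoeffCLM_apply, ← series_bohrIsometry, LinearIsometryEquiv.apply_symm_apply]
  rw [h]
  exact (fourierCoeffCLM p X _).continuous.comp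
    (continuous_subtype_val.comp (bohrIsometry p X).symm.continuous)

/-- Vertical translations act isometrically on `𝓗_p(X)`. -/
theorem Hardy.exists_rotate (t : ℝ) (f : Hardy p X) : ∃ g : Hardy p X, ‖g‖ = ‖f‖ ∧
    ∀ n : ℕ+, g.series n =
      Complex.exp (((t * Real.log (n : ℕ) : ℝ) : ℂ) * Complex.I) • f.series n := by
  obtain ⟨F, rfl⟩ := (bohrIsometry p X).surjective f
  let G : HpTorus p X := ⟨DomMulAct.mk (flow t) • (F : Lp X p haarT), fun α hα => by
    rw [fourierCoeff_smul_flow, F.2 α hα, smul_zero]⟩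
  refine ⟨bohrIsometry p X G, ?_, fun n => ?_⟩
  · simp only [LinearIsometryEquiv.norm_map]
    exact DomMulAct.norm_smul_Lp (DomMulAct.mk (flow t)) (F : Lp X p haarT)
  · rw [series_bohrIsometry, series_bohrIsometry, ← monomial_flow]
    exact fourierCoeff_smul_flow _ _ _

/-- By Fourier inversion `φ((log n - A)/h)` is an average of the characters `n^{2πiv/h}`, so `g` is
the corresponding Bochner integral of rotations of `f`. The constant is the `L_1` norm of `𝓕 φ`;
recentering and rescaling do not change it. -/
theorem Hardy.exists_multiplier (hp' : p ≠ ⊤) (φ : 𝓢(ℝ, ℂ)) : ∃ C : ℝ, 0 ≤ C ∧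
    ∀ (A h : ℝ) (f : Hardy p X), ∃ g : Hardy p X, ‖g‖ ≤ C * ‖f‖ ∧
      ∀ n : ℕ+, g.series n = φ ((Real.log (n : ℕ) - A) / h) • f.series n := by
  -- Finiteness of `p` makes translation strongly continuous on `L_p`, which gives continuity of `T`
  -- below.
  have : Fact (p ≠ ⊤) := ⟨hp'⟩
  refine ⟨∫ v, ‖𝓕 φ v‖, integral_nonneg fun v => norm_nonneg _, fun A h f => ?_⟩
  obtain ⟨F, rfl⟩ := (bohrIsometry p X).surjective f
  -- The phase recenters `φ` at `A`: times `n^{2πiv/h}` it becomes the kernel of the inverse Fourier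
  -- transform at `(log n - A)/h`.
  let κ : ℝ → ℂ := fun v => Complex.exp (((-(2 * Real.pi * v * A / h) : ℝ) : ℂ) * Complex.I) * 𝓕 φ v
  let T : ℝ → Lp X p haarT := fun v =>
    DomMulAct.mk (flow (2 * Real.pi * v / h)) • (F : Lp X p haarT)
  have hT : Continuous T := by
    have h1 : Continuous fun v : ℝ => flow (2 * Real.pi * v / h) :=
      continuous_flow.comp (by fun_prop)
    exact (DomMulAct.continuous_mk.comp h1).smul continuous_const
  have hκ : Continuous κ := by
    have := (𝓕 φ).continuous
    fun_prop
  have hκn : ∀ v, ‖κ v‖ = ‖𝓕 φ v‖ := fun v => by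
    rw [norm_mul, Complex.norm_exp_ofReal_mul_I, one_mul]
  have hTn : ∀ v, ‖T v‖ = ‖F‖ := fun v => DomMulAct.norm_smul_Lp _ _
  have hn : ∀ v, ‖κ v • T v‖ = ‖𝓕 φ v‖ * ‖F‖ := fun v => by rw [norm_smul, hκn, hTn]
  have hint : Integrable fun v => κ v • T v := by
    refine ((𝓕 φ).integrable.norm.mul_const ‖F‖).mono' (hκ.smul hT).aestronglyMeasurable
      (Eventually.of_forall fun v => (hn v).le)
  have hcoef : ∀ α, fourierCoeff (∫ v, κ v • T v) α =
      (∫ v, κ v * monomial α (flow (2 * Real.pi * v / h))) •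
        fourierCoeff (F : Lp X p haarT) α := by
    intro α
    rw [← fourierCoeffCLM_apply, ← ContinuousLinearMap.integral_comp_comm _ hint,
      ← integral_smul_const]
    refine integral_congr_ae (Eventually.of_forall fun v => ?_)
    simp only [map_smul]
    rw [fourierCoeffCLM_apply, fourierCoeff_smul_flow, smul_smul]
  let G : HpTorus p X := ⟨∫ v, κ v • T v, fun α hα => by rw [hcoef, F.2 α hα, smul_zero]⟩
  refine ⟨bohrIsometry p X G, ?_, fun n => ?_⟩
  · simp only [LinearIsometryEquiv.norm_map]
    change ‖∫ v, κ v • T v‖ ≤ _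
    refine (norm_integral_le_integral_norm _).trans_eq ?_
    simp only [hn]
    exact integral_mul_const _ _
  · rw [series_bohrIsometry, series_bohrIsometry]
    refine (hcoef _).trans ?_
    congr 1
    conv_rhs => rw [← FourierTransform.fourierInv_fourier_eq (F := 𝓢(ℝ, ℂ)) φ,
      SchwartzMap.fourierInv_coe, Real.fourierInv_eq']
    refine integral_congr_ae (Eventually.of_forall fun v => ?_)
    simp only [κ, monomial_flow, smul_eq_mul]
    rw [mul_right_comm, ← Complex.exp_add]
    congr 2
    simp only [RCLike.inner_apply, conj_trivial]
    push_cast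
    ring

end Flow

/-! ### Bounds for the partial sum operators -/

section PartialSumOperator

/-- A smooth function equal to `1` on `(-∞, 0]` and to `0` on `[1, ∞)`. -/
noncomputable def smoothCutoff (u : ℝ) : ℝ := Real.smoothTransition (1 - u)

theorem smoothCutoff_of_nonpos {u : ℝ} (h : u ≤ 0) : smoothCutoff u = 1 :=
  Real.smoothTransition.one_of_one_le (by linarith)

theorem smoothCutoff_of_one_le {u : ℝ} (h : 1 ≤ u) : smoothCutoff u = 0 :=
  Real.smoothTransition.zero_of_nonpos (by linarith)

theorem contDiff_smoothCutoff {n : ℕ∞} : ContDiff ℝ n smoothCutoff :=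
  Real.smoothTransition.contDiff.comp (contDiff_const.sub contDiff_id)

theorem exists_schwartz_eq {φ : ℝ → ℝ} (h : ContDiff ℝ ((⊤ : ℕ∞) : WithTop ℕ∞) φ) {a b : ℝ}
    (hs : ∀ u, u ∉ Set.Icc a b → φ u = 0) : ∃ ψ : 𝓢(ℝ, ℂ), ∀ u, ψ u = φ u := by
  have h1 : HasCompactSupport fun u => (φ u : ℂ) :=
    HasCompactSupport.intro isCompact_Icc fun u hu => by rw [hs u hu, Complex.ofReal_zero]
  exact ⟨h1.toSchwartzMap (Complex.ofRealCLM.contDiff.comp h), fun u => rfl⟩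

variable {p : ℝ≥0∞} [Fact (1 ≤ p)] {X : Type*} [NormedAddCommGroup X] [NormedSpace ℂ X]
  [CompleteSpace X]

/-- The cutoff alone is not a Schwartz function, so it is telescoped: a first cutoff of width `A`,
then `k` corrections, each halving the width. Each piece is a rescaling of one of two fixed bumps,
so each costs a constant independent of `A` and `k`. -/
theorem Hardy.exists_cutoff (hp : p ≠ ⊤) : ∃ C : ℝ, 0 ≤ C ∧ ∀ (A : ℝ), 0 < A → ∀ (k : ℕ)
    (f : Hardy p X), ∃ g : Hardy p X, ‖g‖ ≤ C * (k + 1) * ‖f‖ ∧ ∀ n : ℕ+,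
      g.series n = (smoothCutoff ((Real.log (n : ℕ) - A) / (A / 2 ^ k)) : ℂ) • f.series n := by
  -- The correction that halves the width; both terms are `1` left of `0` and `0` right of `1`.
  obtain ⟨β, hβ⟩ := exists_schwartz_eq (φ := fun u => smoothCutoff (2 * u) - smoothCutoff u)
    (a := 0) (b := 1)
    ((contDiff_smoothCutoff.comp (contDiff_const.mul contDiff_id)).sub contDiff_smoothCutoff) (by
      intro u hu
      rw [Set.mem_Icc, not_and_or, not_le, not_le] at hu
      rcases hu with hu | hu
      · simp [smoothCutoff_of_nonpos hu.le, smoothCutoff_of_nonpos (show 2 * u ≤ 0 by linarith)]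
      · simp [smoothCutoff_of_one_le hu.le, smoothCutoff_of_one_le (show 1 ≤ 2 * u by linarith)])
  -- The second factor removes the left tail but equals `1` for `u ≥ -1`. At width `A` nothing is
  -- lost, since `log n ≥ 0` puts `(log n - A)/A` in that range.
  obtain ⟨γ, hγ⟩ := exists_schwartz_eq
    (φ := fun u => smoothCutoff u * smoothCutoff (-1 - u)) (a := -2) (b := 1)
    (contDiff_smoothCutoff.mul (contDiff_smoothCutoff.comp (contDiff_const.sub contDiff_id))) (by
      intro u hu
      rw [Set.mem_Icc, not_and_or, not_le, not_le] at hu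
      rcases hu with hu | hu
      · simp [smoothCutoff_of_one_le (show 1 ≤ -1 - u by linarith)]
      · simp [smoothCutoff_of_one_le hu.le])
  obtain ⟨B, hB0, hB⟩ := Hardy.exists_multiplier (X := X) hp β
  obtain ⟨G, hG0, hG⟩ := Hardy.exists_multiplier (X := X) hp γ
  refine ⟨B + G, by positivity, fun A hA k f => ?_⟩
  induction k with
  | zero =>
    obtain ⟨g, hg, hgs⟩ := hG A A f
    refine ⟨g, hg.trans ?_, fun n => ?_⟩
    · have := mul_nonneg hB0 (norm_nonneg f)
      push_cast
      linarith
    · have hlog : 0 ≤ Real.log (n : ℕ) := Real.log_natCast_nonneg _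
      have h1 : -1 - (Real.log (n : ℕ) - A) / A ≤ 0 := by
        rw [sub_div, div_self hA.ne']
        have := div_nonneg hlog hA.le
        linarith
      rw [hgs, hγ, smoothCutoff_of_nonpos h1, mul_one, pow_zero, div_one]
  | succ k ih =>
    obtain ⟨g, hg, hgs⟩ := ih
    obtain ⟨g', hg', hgs'⟩ := hB A (A / 2 ^ k) f
    refine ⟨g + g', (norm_add_le _ _).trans ?_, fun n => ?_⟩
    · have := mul_nonneg hG0 (norm_nonneg f)
      push_cast
      linarith
    · have h2 : (Real.log (n : ℕ) - A) / (A / 2 ^ (k + 1)) =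
          2 * ((Real.log (n : ℕ) - A) / (A / 2 ^ k)) := by
        field_simp
        ring
      rw [map_add, Pi.add_apply, hgs, hgs', hβ, ← add_smul, h2]
      congr 1
      push_cast
      ring

/-- The partial sum operators on `𝓗_p(X)` have norms that grow more slowly than any power. -/
theorem Hardy.exists_truncation (hp : p ≠ ⊤) {σ : ℝ} (hσ : 0 < σ) : ∃ C : ℝ, ∀ (N : ℕ+)
    (f : Hardy p X), ∃ g : Hardy p X, ‖g‖ ≤ C * ((N : ℕ) : ℝ) ^ σ * ‖f‖ ∧ ∀ n : ℕ+,
      g.series n = if n ≤ N then f.series n else 0 := by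
  obtain ⟨C, hC0, hC⟩ := Hardy.exists_cutoff (p := p) (X := X) hp
  refine ⟨C * (2 / (σ * Real.log 2) + 4), fun N f => ?_⟩
  set l := Nat.log 2 N with hl
  have hN1 : (1 : ℝ) ≤ (N : ℕ) := Nat.one_le_cast.mpr N.pos
  have hN0 : (0 : ℝ) < (N : ℕ) := by linarith
  have hl1 : (2 : ℝ) ^ l ≤ (N : ℕ) := by exact_mod_cast Nat.pow_log_le_self 2 N.ne_zero
  have hl2 : ((N : ℕ) : ℝ) + 1 ≤ 2 ^ (l + 1) := by
    exact_mod_cast Nat.lt_pow_succ_log_self one_lt_two (N : ℕ)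
  -- The midpoint of the gap: a cutoff starting here, of width at most half the gap, is `1` for `n ≤
  -- N` and `0` for `n ≥ N + 1`.
  set A := (Real.log (N : ℕ) + Real.log ((N : ℕ) + 1)) / 2 with hA
  have hlogN : 0 ≤ Real.log (N : ℕ) := Real.log_natCast_nonneg _
  have hgap : 1 / (((N : ℕ) : ℝ) + 1) ≤ Real.log ((N : ℕ) + 1) - Real.log (N : ℕ) := by
    rw [← Real.log_div (by positivity) hN0.ne']
    refine le_trans (le_of_eq ?_) (Real.one_sub_inv_le_log_of_pos (by positivity))
    field_simp
    ring
  have hgap0 : 0 < 1 / (((N : ℕ) : ℝ) + 1) := by positivity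
  have hA0 : 0 < A := by linarith
  -- The gap is at least `1/(N + 1)` and `A ≤ N + 1`, so `2 (N + 1)²` is a sufficient power of two;
  -- `2l + 3` supplies it because `N + 1 ≤ 2^(l + 1)`.
  have hh : A / 2 ^ (2 * l + 3) ≤ (Real.log ((N : ℕ) + 1) - Real.log (N : ℕ)) / 2 := by
    have h1 : A ≤ (N : ℕ) + 1 := by
      have := Real.log_le_self (show (0 : ℝ) ≤ (N : ℕ) + 1 by positivity)
      linarith
    have h2 : A / 2 ^ (2 * l + 3) ≤ (1 / (((N : ℕ) : ℝ) + 1)) / 2 := by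
      have h3 : (2 : ℝ) ^ (2 * l + 3) = 2 ^ (l + 1) * 2 ^ (l + 1) * 2 := by ring
      rw [div_le_iff₀ (by positivity), h3]
      calc A ≤ (1 / (((N : ℕ) : ℝ) + 1)) / 2 * ((((N : ℕ) : ℝ) + 1) * (((N : ℕ) : ℝ) + 1) * 2) := by
            refine h1.trans (le_of_eq ?_)
            field_simp
        _ ≤ _ := by gcongr
    linarith
  obtain ⟨g, hg, hgs⟩ := hC A hA0 (2 * l + 3) f
  refine ⟨g, hg.trans ?_, fun n => ?_⟩
  · have h2 : 0 < Real.log 2 := Real.log_pos one_lt_two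
    have h3 : (l : ℝ) * Real.log 2 ≤ ((N : ℕ) : ℝ) ^ σ / σ := by
      rw [← Real.log_pow]
      exact (Real.log_le_log (by positivity) hl1).trans (Real.log_le_rpow_div hN0.le hσ)
    have h4 : (1 : ℝ) ≤ ((N : ℕ) : ℝ) ^ σ := Real.one_le_rpow hN1 hσ.le
    have h5 : (l : ℝ) ≤ 1 / (σ * Real.log 2) * ((N : ℕ) : ℝ) ^ σ := by
      rw [← le_div_iff₀ h2] at h3
      refine h3.trans (le_of_eq ?_)
      field_simp
    have h6 : ((2 * l + 3 : ℕ) : ℝ) + 1 ≤ (2 / (σ * Real.log 2) + 4) * ((N : ℕ) : ℝ) ^ σ := by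
      push_cast
      calc (2 * (l : ℝ) + 3 + 1) ≤ 2 * (1 / (σ * Real.log 2) * ((N : ℕ) : ℝ) ^ σ) +
            4 * ((N : ℕ) : ℝ) ^ σ := by linarith
        _ = _ := by ring
    refine mul_le_mul_of_nonneg_right ?_ (norm_nonneg f)
    rw [mul_assoc C]
    gcongr
  · rw [hgs]
    split_ifs with hn
    · have h1 : Real.log (n : ℕ) ≤ Real.log (N : ℕ) :=
        Real.log_le_log (Nat.cast_pos.mpr n.pos) (by exact_mod_cast hn)
      rw [smoothCutoff_of_nonpos, Complex.ofReal_one, one_smul]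
      exact div_nonpos_of_nonpos_of_nonneg (by linarith) (by positivity)
    · have h1 : Real.log ((N : ℕ) + 1) ≤ Real.log (n : ℕ) := by
        refine Real.log_le_log (by positivity) ?_
        have : (N : ℕ) + 1 ≤ n := not_le.mp hn
        exact_mod_cast this
      rw [smoothCutoff_of_one_le, Complex.ofReal_zero, zero_smul]
      rw [one_le_div (by positivity)]
      linarith

/-- One term is the difference of two consecutive truncations, or the first truncation when `n = 1`.
-/
theorem Hardy.single_mem (hp : p ≠ ⊤) (f : Hardy p X) (n : ℕ+) :
    Pi.single n (f.series n) ∈ hardySubmodule p X := by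
  obtain ⟨C, hC⟩ := Hardy.exists_truncation (p := p) (X := X) hp one_pos
  obtain ⟨g, -, hg⟩ := hC n f
  have hs : ∀ f : Hardy p X, f.series ∈ hardySubmodule p X := fun f => f.2
  by_cases h1 : n = 1
  · convert hs g using 1
    funext m
    rw [hg]
    subst h1
    by_cases hm : m = 1
    · subst hm; simp
    · rw [Pi.single_eq_of_ne hm, if_neg (by simpa using hm)]
  · obtain ⟨k, rfl⟩ := PNat.exists_eq_succ_of_ne_one h1
    obtain ⟨g', -, hg'⟩ := hC k f
    convert hs (g - g') using 1
    funext m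
    rw [map_sub, Pi.sub_apply, hg, hg']
    by_cases hm : m = k + 1
    · subst hm
      simp [(PNat.lt_add_right k 1).not_ge]
    · rw [Pi.single_eq_of_ne hm]
      have h2 : m ≤ k + 1 ↔ m ≤ k := by
        rw [le_iff_lt_or_eq, or_iff_left hm, PNat.lt_add_one_iff]
      simp [h2]

end PartialSumOperator

/-! ### Convergence and holomorphy by summation by parts -/

section AbelSummation

/-- Mean value inequality for `x ↦ x^{-w}` on `[n, n + 1]`; the bound on the derivative is largest
at the left endpoint. -/
theorem norm_cpow_sub_cpow_succ_le (n : ℕ+) (w : ℂ) (hw : 0 ≤ w.re) :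
    ‖((n : ℕ) : ℂ) ^ (-w) - (((n + 1 : ℕ+) : ℕ) : ℂ) ^ (-w)‖ ≤
      ‖w‖ * ((n : ℕ) : ℝ) ^ (-w.re - 1) := by
  have hn : (0 : ℝ) < (n : ℕ) := Nat.cast_pos.mpr n.pos
  have hd : ∀ x ∈ Set.Icc ((n : ℕ) : ℝ) ((n : ℕ) + 1),
      HasDerivWithinAt (fun y : ℝ => (y : ℂ) ^ (-w)) (-w * (x : ℂ) ^ (-w - 1))
        (Set.Icc ((n : ℕ) : ℝ) ((n : ℕ) + 1)) x := by
    intro x hx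
    have hx0 : 0 < x := hn.trans_le hx.1
    have h := ((hasDerivAt_id (x : ℂ)).cpow_const (c := -w) (Or.inl (by simpa using hx0)))
    simpa using h.comp_ofReal.hasDerivWithinAt
  have hb : ∀ x ∈ Set.Ico ((n : ℕ) : ℝ) ((n : ℕ) + 1),
      ‖-w * (x : ℂ) ^ (-w - 1)‖ ≤ ‖w‖ * ((n : ℕ) : ℝ) ^ (-w.re - 1) := by
    intro x hx
    have hx0 : 0 < x := hn.trans_le hx.1
    rw [norm_mul, norm_neg, Complex.norm_cpow_eq_rpow_re_of_pos hx0]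
    refine mul_le_mul_of_nonneg_left ?_ (norm_nonneg w)
    simp only [Complex.sub_re, Complex.neg_re, Complex.one_re]
    exact Real.rpow_le_rpow_of_nonpos hn hx.1 (by linarith)
  have h := norm_image_sub_le_of_norm_deriv_le_segment' hd hb _
    (Set.right_mem_Icc.mpr (by linarith))
  rw [norm_sub_rev]
  simpa using h

variable {Y : Type*} [NormedAddCommGroup Y] [NormedSpace ℂ Y]

theorem partialSum_one (a : DirichletSeries Y) (s : ℂ) : partialSum a s 1 = a 1 := by
  simp [partialSum]

theorem partialSum_add_one (a : DirichletSeries Y) (s : ℂ) (N : ℕ+) :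
    partialSum a s (N + 1) =
      partialSum a s N + (((N + 1 : ℕ+) : ℕ) : ℂ) ^ (-s) • a (N + 1) := by
  have he : Finset.Icc 1 (N + 1) = insert (N + 1) (Finset.Icc 1 N) := by
    ext m
    rw [Finset.mem_insert, Finset.mem_Icc, Finset.mem_Icc, le_iff_lt_or_eq (b := N + 1),
      PNat.lt_add_one_iff]
    simp [or_comm]
  rw [partialSum, he, Finset.sum_insert, add_comm]
  · rfl
  · simp [(PNat.lt_add_right N 1).not_ge]

theorem succPNat_succ (N : ℕ) : (N + 1).succPNat = N.succPNat + 1 := rfl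

/-- Summation by parts. -/
theorem partialSum_eq_abel (a : DirichletSeries Y) (s w : ℂ) (N : ℕ) :
    partialSum a (s + w) N.succPNat =
      ∑ i ∈ Finset.range N, (((i.succPNat : ℕ) : ℂ) ^ (-w) -
        (((i.succPNat + 1 : ℕ+) : ℕ) : ℂ) ^ (-w)) • partialSum a s i.succPNat +
      ((N.succPNat : ℕ) : ℂ) ^ (-w) • partialSum a s N.succPNat := by
  induction N with
  | zero =>
    have : Nat.succPNat 0 = 1 := rfl
    simp [this, partialSum_one]
  | succ N ih =>
    have h0 : (((N.succPNat + 1 : ℕ+) : ℕ) : ℂ) ≠ 0 := Nat.cast_ne_zero.mpr (PNat.ne_zero _)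
    rw [succPNat_succ, partialSum_add_one, ih, Finset.sum_range_succ, partialSum_add_one,
      neg_add, add_comm (-s), Complex.cpow_add _ _ h0, smul_add, smul_smul, sub_smul]
    abel

theorem tendsto_of_comp_succPNat {α : Type*} {u : ℕ+ → α} {l : Filter α}
    (h : Tendsto (fun N : ℕ => u N.succPNat) atTop l) : Tendsto u atTop l := by
  have h1 : Tendsto PNat.natPred atTop atTop := by
    refine tendsto_atTop_atTop.mpr fun N => ⟨N.succPNat, fun n hn => ?_⟩
    have : N + 1 ≤ (n : ℕ) := by exact_mod_cast hn
    rw [PNat.natPred]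
    omega
  exact (h.comp h1).congr fun n => by rw [Function.comp_apply, PNat.succPNat_natPred]

variable [CompleteSpace Y]

/-- Summation by parts with `w = s - σ`, where `Re w > 2σ` near `s₀`. The differences of `n^{-w}`
are `O(n^{-2σ-1})` and the partial sums `O(n^σ)`, so the series is dominated by `∑ n^{-σ-1}`, while
the boundary term is `O(N^{-σ})`. -/
theorem exists_tendsto_partialSum_near (a : DirichletSeries Y) {σ C : ℝ} (hσ : 0 < σ)
    (hC : ∀ N : ℕ+, ‖partialSum a (σ : ℂ) N‖ ≤ C * ((N : ℕ) : ℝ) ^ σ) (s₀ : ℂ)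
    (hs₀ : 3 * σ < s₀.re) : ∃ G : ℂ → Y,
      (∀ᶠ s in 𝓝 s₀, Tendsto (partialSum a s) atTop (𝓝 (G s))) ∧ DifferentiableAt ℂ G s₀ := by
  let R := ‖s₀‖ + 1
  -- Bounded, so that the factor `‖s - σ‖` from the mean value inequality is at most `R + σ`
  -- uniformly on `U`.
  let U : Set ℂ := {s | 3 * σ < s.re} ∩ Metric.ball 0 R
  have hU : IsOpen U := (isOpen_lt continuous_const Complex.continuous_re).inter Metric.isOpen_ball
  have hU₀ : s₀ ∈ U := ⟨hs₀, by simp [R]⟩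
  let f : ℕ → ℂ → Y := fun i s => (((i.succPNat : ℕ) : ℂ) ^ (-(s - σ)) -
    (((i.succPNat + 1 : ℕ+) : ℕ) : ℂ) ^ (-(s - σ))) • partialSum a (σ : ℂ) i.succPNat
  let u : ℕ → ℝ := fun i => (R + σ) * C * ((i.succPNat : ℕ) : ℝ) ^ (-σ - 1)
  have hu : Summable u := by
    refine Summable.mul_left _ ?_
    have h := (summable_nat_add_iff (f := fun n : ℕ => (n : ℝ) ^ (-σ - 1)) 1).mpr
      (Real.summable_nat_rpow.mpr (by linarith))
    simpa using h
  have hC0 : 0 ≤ C := by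
    have h := (norm_nonneg _).trans (hC 1)
    simpa using h
  have hf : ∀ i s, s ∈ U → ‖f i s‖ ≤ u i := by
    rintro i s ⟨hs, hsR⟩
    have hs : 3 * σ < s.re := hs
    have hn : (1 : ℝ) ≤ (i.succPNat : ℕ) := Nat.one_le_cast.mpr (PNat.pos _)
    have hre : (s - σ).re = s.re - σ := by simp
    have h1 := norm_cpow_sub_cpow_succ_le i.succPNat (s - σ) (by rw [hre]; linarith)
    have h2 : ‖s - σ‖ ≤ R + σ := by
      refine (norm_sub_le _ _).trans (add_le_add ?_ ?_)
      · simpa using (mem_ball_zero_iff.mp hsR).le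
      · rw [Complex.norm_real, Real.norm_of_nonneg hσ.le]
    have hRσ : 0 ≤ R + σ := (norm_nonneg _).trans h2
    calc ‖f i s‖ = _ := norm_smul _ _
      _ ≤ ((R + σ) * ((i.succPNat : ℕ) : ℝ) ^ (-2 * σ - 1)) * (C * ((i.succPNat : ℕ) : ℝ) ^ σ) := by
          refine mul_le_mul (h1.trans ?_) (hC _) (norm_nonneg _) (by positivity)
          refine mul_le_mul h2 (Real.rpow_le_rpow_of_exponent_le hn ?_) (by positivity) hRσ
          rw [hre]
          linarith
      _ = (R + σ) * C * (((i.succPNat : ℕ) : ℝ) ^ (-2 * σ - 1) * ((i.succPNat : ℕ) : ℝ) ^ σ) := by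
          ring
      _ = u i := by
          rw [← Real.rpow_add (by linarith)]
          congr 2
          ring
  refine ⟨fun s => ∑' i, f i s, ?_, ?_⟩
  · filter_upwards [hU.mem_nhds hU₀] with s hs
    have hs' : 3 * σ < s.re := hs.1
    refine tendsto_of_comp_succPNat ?_
    have h1 : Tendsto (fun N : ℕ => ∑ i ∈ Finset.range N, f i s) atTop (𝓝 (∑' i, f i s)) :=
      (Summable.of_norm_bounded hu fun i => hf i s hs).hasSum.tendsto_sum_nat
    have h2 : Tendsto (fun N : ℕ => ((N.succPNat : ℕ) : ℂ) ^ (-(s - σ)) •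
        partialSum a (σ : ℂ) N.succPNat) atTop (𝓝 0) := by
      refine squeeze_zero_norm (a := fun N : ℕ => C * ((N.succPNat : ℕ) : ℝ) ^ (-σ)) (fun N => ?_) ?_
      · have hn : (1 : ℝ) ≤ (N.succPNat : ℕ) := Nat.one_le_cast.mpr (PNat.pos _)
        rw [norm_smul, Complex.norm_natCast_cpow_of_pos (PNat.pos _)]
        calc _ ≤ ((N.succPNat : ℕ) : ℝ) ^ (-2 * σ) * (C * ((N.succPNat : ℕ) : ℝ) ^ σ) := by
              refine mul_le_mul (Real.rpow_le_rpow_of_exponent_le hn ?_) (hC _) (norm_nonneg _)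
                (by positivity)
              simp
              linarith
          _ = C * (((N.succPNat : ℕ) : ℝ) ^ (-2 * σ) * ((N.succPNat : ℕ) : ℝ) ^ σ) := by ring
          _ = _ := by
              rw [← Real.rpow_add (by linarith)]
              congr 2
              ring
      · have h3 := (tendsto_rpow_neg_atTop hσ).comp
          (tendsto_natCast_atTop_atTop.comp (tendsto_add_atTop_nat 1))
        simpa [Function.comp_def] using h3.const_mul C
    have h3 := h1.add h2
    rw [add_zero] at h3
    refine h3.congr fun N => ?_
    rw [← partialSum_eq_abel a (σ : ℂ) (s - σ) N, add_sub_cancel]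
  · refine (Complex.differentiableOn_tsum_of_summable_norm hu (fun i => ?_) hU hf).differentiableAt
      (hU.mem_nhds hU₀)
    have h0 : ∀ n : ℕ+, Differentiable ℂ fun s : ℂ => ((n : ℕ) : ℂ) ^ (-(s - σ)) := fun n =>
      (differentiable_id.sub_const _).neg.const_cpow (Or.inl (Nat.cast_ne_zero.mpr n.ne_zero))
    exact (((h0 _).sub (h0 _)).smul_const _).differentiableOn

/-- A Dirichlet series whose partial sums at `σ` grow at most like `N ^ σ`, for all `σ > 0`,
converges on the right half-plane to a holomorphic function. -/
theorem exists_tendsto_partialSum (a : DirichletSeries Y)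
    (h : ∀ σ : ℝ, 0 < σ → ∃ C : ℝ, ∀ N : ℕ+, ‖partialSum a (σ : ℂ) N‖ ≤ C * ((N : ℕ) : ℝ) ^ σ) :
    ∃ F : ℂ → Y, (∀ s ∈ halfPlane, Tendsto (partialSum a s) atTop (𝓝 (F s))) ∧
      DifferentiableOn ℂ F halfPlane := by
  have key : ∀ s₀ ∈ halfPlane, ∃ G : ℂ → Y,
      (∀ᶠ s in 𝓝 s₀, Tendsto (partialSum a s) atTop (𝓝 (G s))) ∧ DifferentiableAt ℂ G s₀ := by
    intro s₀ hs₀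
    have hs₀ : 0 < s₀.re := hs₀
    obtain ⟨C, hC⟩ := h (s₀.re / 4) (by linarith)
    exact exists_tendsto_partialSum_near a (by linarith) hC s₀ (by linarith)
  have hlim : ∀ s ∈ halfPlane,
      Tendsto (partialSum a s) atTop (𝓝 (limUnder atTop (partialSum a s))) := fun s hs => by
    obtain ⟨G, hG, -⟩ := key s hs
    exact tendsto_nhds_limUnder ⟨_, hG.self_of_nhds⟩
  -- The local limit functions agree with the pointwise limit, so holomorphy passes to it.
  refine ⟨fun s => limUnder atTop (partialSum a s), hlim, fun s hs => ?_⟩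
  obtain ⟨G, hG, hG'⟩ := key s hs
  refine (hG'.congr_of_eventuallyEq ?_).differentiableWithinAt
  filter_upwards [hG] with z hz
  exact hz.limUnder_eq

end AbelSummation

/-! ### The isometric embedding -/

section Embedding

variable {p : ℝ≥0∞} [Fact (1 ≤ p)] {X : Type*} [NormedAddCommGroup X] [NormedSpace ℂ X]
  [CompleteSpace X]

theorem HardyPlus.series_shift (D : HardyPlus p X) (ε : Set.Ioi (0 : ℝ)) (n : ℕ+) :
    (HardyPlus.shift ε D).series n = (((n : ℕ) : ℂ) ^ (-((ε : ℝ) : ℂ))) • D.series n := rfl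

/-- The case of `D_1`, which lies in `𝓗_p(X)`, rescaled by the nonzero factor `n`. -/
theorem HardyPlus.single_mem (hp : p ≠ ⊤) (D : HardyPlus p X) (n : ℕ+) :
    Pi.single n (D.series n) ∈ hardySubmodule p X := by
  have h0 : (((n : ℕ) : ℂ) ^ (-((1 : ℝ) : ℂ))) ≠ 0 := by
    rw [Ne, Complex.cpow_eq_zero_iff]
    simp
  have h := (hardySubmodule p X).smul_mem (((n : ℕ) : ℂ) ^ (-((1 : ℝ) : ℂ)))⁻¹
    (Hardy.single_mem hp (HardyPlus.shift ⟨1, one_pos (α := ℝ)⟩ D) n)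
  rwa [← Pi.single_smul, HardyPlus.series_shift, inv_smul_smul₀ h0] at h

/-- The terms `aₙ n^{-s}` of `D`, as elements of `𝓗_p(X)`. -/
noncomputable def HardyPlus.terms (hp : p ≠ ⊤) (D : HardyPlus p X) :
    DirichletSeries (Hardy p X) :=
  fun n => Hardy.mk (Pi.single n (D.series n)) (D.single_mem hp n)

theorem HardyPlus.series_terms (hp : p ≠ ⊤) (D : HardyPlus p X) (n : ℕ+) :
    (D.terms hp n).series = Pi.single n (D.series n) := rfl

theorem HardyPlus.terms_add (hp : p ≠ ⊤) (D E : HardyPlus p X) :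
    (D + E).terms hp = D.terms hp + E.terms hp :=
  funext fun n => Hardy.ext fun m => by
    rw [Pi.add_apply, map_add, HardyPlus.series_terms, HardyPlus.series_terms,
      HardyPlus.series_terms, map_add, Pi.add_apply, Pi.single_add]

theorem HardyPlus.terms_smul (hp : p ≠ ⊤) (c : ℂ) (D : HardyPlus p X) :
    (c • D).terms hp = c • D.terms hp :=
  funext fun n => Hardy.ext fun m => by
    rw [Pi.smul_apply, map_smul, HardyPlus.series_terms, HardyPlus.series_terms, map_smul,
      Pi.smul_apply, Pi.single_smul]

theorem HardyPlus.series_partialSum_terms (hp : p ≠ ⊤) (D : HardyPlus p X) (s : ℂ) (N m : ℕ+) :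
    (partialSum (D.terms hp) s N).series m =
      if m ≤ N then (((m : ℕ) : ℂ) ^ (-s)) • D.series m else 0 := by
  simp only [partialSum, map_sum, map_smul, Finset.sum_apply, Pi.smul_apply,
    HardyPlus.series_terms, Pi.single_apply, smul_ite, smul_zero]
  rw [Finset.sum_ite_eq]
  simp

/-- Partial sums at `σ` are truncations of `D_σ`, so the growth criterion applies. The limit at `s`
is then identified by its coefficients as a rotation of `D_{Re s}`. -/
theorem HardyPlus.exists_limit (hp : p ≠ ⊤) (D : HardyPlus p X) : ∃ F : ℂ → Hardy p X,
    (∀ s ∈ halfPlane, Tendsto (partialSum (D.terms hp) s) atTop (𝓝 (F s))) ∧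
      DifferentiableOn ℂ F halfPlane ∧
      ∀ (s : ℂ) (hs : s ∈ halfPlane), ‖F s‖ = ‖HardyPlus.shift ⟨s.re, hs⟩ D‖ := by
  obtain ⟨F, hF, hF'⟩ := exists_tendsto_partialSum (D.terms hp) fun σ hσ => by
    obtain ⟨C, hC⟩ := Hardy.exists_truncation (p := p) (X := X) hp hσ
    refine ⟨C * ‖HardyPlus.shift ⟨σ, hσ⟩ D‖, fun N => ?_⟩
    obtain ⟨g, hg, hgs⟩ := hC N (HardyPlus.shift ⟨σ, hσ⟩ D)
    have h : partialSum (D.terms hp) (σ : ℂ) N = g := Hardy.ext fun m => by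
      rw [HardyPlus.series_partialSum_terms, hgs]
      rfl
    rw [h, mul_right_comm]
    exact hg
  refine ⟨F, hF, hF', fun s hs => ?_⟩
  -- Coefficients are continuous on `𝓗_p(X)`, and the `m`-th coefficient of the partial sums is
  -- constant once `N ≥ m`.
  have hcoef : ∀ m : ℕ+, (F s).series m = (((m : ℕ) : ℂ) ^ (-s)) • D.series m := fun m => by
    refine tendsto_nhds_unique (((Hardy.continuous_series m).tendsto _).comp (hF s hs)) ?_
    refine tendsto_const_nhds.congr' ?_
    filter_upwards [eventually_ge_atTop m] with N hN
    rw [Function.comp_apply, HardyPlus.series_partialSum_terms, if_pos hN]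
  -- `n^{-s} = n^{-Re s} n^{-i Im s}`, so the rotation time is `-Im s`.
  obtain ⟨g, hg, hgs⟩ := Hardy.exists_rotate (-s.im) (HardyPlus.shift ⟨s.re, hs⟩ D)
  rw [← hg]
  congr 1
  refine Hardy.ext fun m => ?_
  have hm : ((m : ℕ) : ℂ) ≠ 0 := Nat.cast_ne_zero.mpr m.ne_zero
  rw [hcoef, hgs, HardyPlus.series_shift, smul_smul, Complex.cpow_def_of_ne_zero hm,
    Complex.cpow_def_of_ne_zero hm, ← Complex.exp_add, ← Complex.natCast_log]
  congr 2
  conv_lhs => rw [← Complex.re_add_im s]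
  push_cast
  ring

/-- The map `∑ₙ aₙ n^{-s} ↦ ∑ₙ (aₙ n^{-s}) n^{-z}`. -/
noncomputable def HardyPlus.toDInfty (hp : p ≠ ⊤) : HardyPlus p X →ₗ[ℂ] DInfty (Hardy p X) where
  toFun D := ⟨D.terms hp, by
    obtain ⟨F, hF, hF', hn⟩ := D.exists_limit hp
    exact ⟨F, hF, hF', ‖D‖, fun s hs => (hn s hs).trans_le (le_ciSup D.bddAbove ⟨s.re, hs⟩)⟩⟩
  map_add' D E := Subtype.ext (HardyPlus.terms_add hp D E)
  map_smul' c D := Subtype.ext (HardyPlus.terms_smul hp c D)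

theorem HardyPlus.series_toDInfty (hp : p ≠ ⊤) (D : HardyPlus p X) :
    (HardyPlus.toDInfty hp D).series = D.terms hp := rfl

theorem HardyPlus.norm_toDInfty (hp : p ≠ ⊤) (D : HardyPlus p X) :
    ‖HardyPlus.toDInfty hp D‖ = ‖D‖ := by
  obtain ⟨F, hF, -, hn⟩ := D.exists_limit hp
  have he : ∀ s : halfPlane, ‖(HardyPlus.toDInfty hp D).eval s‖ =
      ‖HardyPlus.shift ⟨(s : ℂ).re, s.2⟩ D‖ := fun s => by
    have h := (HardyPlus.toDInfty hp D).tendsto_eval s.2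
    rw [HardyPlus.series_toDInfty] at h
    rw [← hn s s.2, tendsto_nhds_unique h (hF s s.2)]
  rw [DInfty.norm_def, HardyPlus.norm_def]
  simp only [he]
  -- The norm of the value at `s` depends only on `Re s`, and `Re` maps the half-plane onto `(0,
  -- ∞)`, so the two suprema coincide.
  have hsurj : Function.Surjective fun s : halfPlane =>
      (⟨(s : ℂ).re, s.2⟩ : Set.Ioi (0 : ℝ)) := fun ε =>
    ⟨⟨((ε : ℝ) : ℂ), ε.2⟩, rfl⟩
  exact hsurj.iSup_comp fun ε => ‖HardyPlus.shift ε D‖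

end Embedding

end DirichletHardy

/-- For `1 ≤ p < ∞` and a complex Banach space `X`, the map
`∑ₙ aₙ n^{-s} ↦ ∑ₙ (aₙ n^{-s}) n^{-z}` is a well-defined linear isometric embedding
`𝓗_p⁺(X) ↪ 𝔇_∞(𝓗_p(X))`: the `n`-th coefficient of the image is the one-term Dirichlet series
`aₙ n^{-s}`, as an element of `𝓗_p(X)`. -/
theorem mainTheorem10 (p : ENNReal) [Fact (1 ≤ p)] (hp : p ≠ ⊤)
    (X : Type*) [NormedAddCommGroup X] [NormedSpace ℂ X] [CompleteSpace X] :
    ∃ Φ : DirichletHardy.HardyPlus p X →ₗᵢ[ℂ] DirichletHardy.DInfty (DirichletHardy.Hardy p X),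
      ∀ (D : DirichletHardy.HardyPlus p X) (n : ℕ+),
        DirichletHardy.Hardy.series (DirichletHardy.DInfty.series (Φ D) n) =
          Pi.single n (DirichletHardy.HardyPlus.series D n) := by
  refine ⟨⟨DirichletHardy.HardyPlus.toDInfty hp, DirichletHardy.HardyPlus.norm_toDInfty hp⟩,
    fun D n => ?_⟩
  change DirichletHardy.Hardy.series
    (DirichletHardy.DInfty.series (DirichletHardy.HardyPlus.toDInfty hp D) n) = _
  rw [DirichletHardy.HardyPlus.series_toDInfty, DirichletHardy.HardyPlus.series_terms]
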